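/- Let $p$ be a prime, let $0<i<s$ be integers with $s>1$, put $q=p^s$ and $m=\gcd(i,s)$, and suppose $p^m\ge 3$. Let either $h=\frac{q-p^i}{2}$ ($p$ arbitrary) or $h=\frac{p^i-1}{2}$ ($p$ odd). Let $\beta\in\mathbb{F}_{q^2}$ be any primitive $(q+1)$-th root of unity, let $M_{\beta^j}(x)\in\mathbb{F}_q[x]$ be the minimal polynomial of $\beta^j$ over $\mathbb{F}_q$, and let $\mathcal{C}=\mathcal{C}_{(q,q+1,3,h)}$ be the BCH code of length $q+1$ over $\mathbb{F}_q$ with designed distance $3$, that is, the cyclic code generated by $\mathrm{lcm}(M_{\beta^h}(x),M_{\beta^{h+1}}(x))$: the set of $(c_0,\dots,c_q)\in\mathbb{F}_q^{q+1}$ such that the class of $c_0+c_1x+\cdots+c_qx^q$ lies in the ideal of $\mathbb{F}_q[x]/(x^{q+1}-1)$ generated by this polynomial. Write $[n,k,d]$ for a linear code of length $n$, dimension $k$ and minimum Hamming distance $d$; such a code is almost MDS (AMDS) if $d=n-k$. Then $\mathcal{C}$ is an AMDS code with parameters $[q+1,q-3,4]$, and its dual code $\mathcal{C}^\perp=\{v\in\mathbb{F}_q^{q+1}: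 c\cdot v=0 \text{ for all } c\in\mathcal{C}\}$ has parameters $[q+1,4,q-p^m]$. -/

import Mathlib

open Polynomial

noncomputable section

/-- `IsMinDist C d`: the minimum distance of the linear code `C` is `d`, that is, `d` is the least
Hamming weight of a nonzero codeword. It is never satisfied by the zero code. -/
def IsMinDist {F : Type*} [Field F] [DecidableEq F] {n : ℕ} (C : Submodule F (Fin n → F))
    (d : ℕ) : Prop :=
  IsLeast {w : ℕ | ∃ c ∈ C, c ≠ 0 ∧ hammingNorm c = w} d

/-- `HasParameters C k d`: the linear code `C` of length `n` is an `[n, k, d]` code. -/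
def HasParameters {F : Type*} [Field F] [DecidableEq F] {n : ℕ} (C : Submodule F (Fin n → F))
    (k d : ℕ) : Prop :=
  Module.finrank F C = k ∧ IsMinDist C d

/-- An almost MDS code of length `n` is an `[n, k, n - k]` code. -/
def IsAMDS {F : Type*} [Field F] [DecidableEq F] {n : ℕ} (C : Submodule F (Fin n → F)) : Prop :=
  ∃ k d : ℕ, HasParameters C k d ∧ k + d = n

/-- The dual code `{v | c ⬝ v = 0 for all c ∈ C}`. -/
def dualCode {F : Type*} [Field F] {n : ℕ} (C : Submodule F (Fin n → F)) :
    Submodule F (Fin n → F) where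
  carrier := {v | ∀ c ∈ C, c ⬝ᵥ v = 0}
  add_mem' := by
    intro v w hv hw c hc
    rw [dotProduct_add, hv c hc, hw c hc, add_zero]
  zero_mem' := by
    intro c _
    exact dotProduct_zero c
  smul_mem' := by
    intro a v hv c hc
    rw [dotProduct_smul, hv c hc, smul_zero]

/-- The linear map `(c₀, …, cₙ₋₁) ↦ c₀ + c₁ x + ⋯ + cₙ₋₁ xⁿ⁻¹` from `Fⁿ` to `F[x] / (xⁿ - 1)`. -/
def codewordMap (F : Type*) [Field F] (n : ℕ) :
    (Fin n → F) →ₗ[F] F[X] ⧸ Ideal.span {(X ^ n - 1 : F[X])} where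
  toFun c := Ideal.Quotient.mk _ (∑ i : Fin n, C (c i) * X ^ (i : ℕ))
  map_add' := by
    intro c d
    rw [← map_add, ← Finset.sum_add_distrib]
    simp only [Pi.add_apply, C_add, add_mul]
  map_smul' := by
    intro a c
    have h : ∑ i : Fin n, C ((a • c) i) * (X : F[X]) ^ (i : ℕ)
        = a • ∑ i : Fin n, C (c i) * X ^ (i : ℕ) := by
      rw [Finset.smul_sum]
      refine Finset.sum_congr rfl fun i _ => ?_
      rw [Pi.smul_apply, smul_eq_mul, C_mul, mul_assoc, ← smul_eq_C_mul]
    rw [h]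
    rfl

/-- The cyclic code of length `n` over `F` generated by the polynomial `g`: the words whose
polynomial lies in the ideal of `F[x] / (xⁿ - 1)` generated by `g`. -/
def cyclicCode {F : Type*} [Field F] (n : ℕ) (g : F[X]) : Submodule F (Fin n → F) :=
  ((Ideal.span {Ideal.Quotient.mk (Ideal.span {(X ^ n - 1 : F[X])}) g}).restrictScalars F).comap
    (codewordMap F n)

open Classical in
/-- The monic polynomial `lcm (M_{β^h}, M_{β^(h+1)}, …, M_{β^(h+δ-2)})`, where `M_{β^j}` is the minimal
polynomial of `β ^ j` over `F`. -/
def bchGenerator (F : Type*) {K : Type*} [Field F] [Field K] [Algebra F K] (β : K) (δ h : ℕ) :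
    F[X] :=
  letI : NormalizedGCDMonoid F[X] := UniqueFactorizationMonoid.toNormalizedGCDMonoid F[X]
  (Finset.range (δ - 1)).lcm fun j => minpoly F (β ^ (h + j))

/-- The BCH code of length `n` and designed distance `δ` over `F` with first exponent `h`, formed
with the primitive `n`-th root of unity `β`. -/
def bchCode (F : Type*) {K : Type*} [Field F] [Field K] [Algebra F K] (n : ℕ) (β : K) (δ h : ℕ) :
    Submodule F (Fin n → F) :=
  cyclicCode n (bchGenerator F β δ h)

end

/-! Let U be the group of (q+1)-th roots of unity in K and Q = p^i. By nondegeneracy of the trace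
form, the BCH code is the dual of the code of words Tr(a x^h + b x^(h+1)), x in U
(`bchCode_three_eq_dualCode`). Both choices of h are such that on U this trace is a power of x times
A + Bx + B^q x^Q + A^q x^(Q+1) (`exists_involutive_add_conj_eq`).

A zero x thus satisfies a Möbius relation between x and x^Q, so cross-ratios of zeros are fixed by
the Q-power map; since x^q = 1/x on U, they are fixed by the q-power map too. They lie in the field
of order p^m, so there are at most p^m + 1 zeros (`card_zeros_le`). A copy of the projective line
over that field inside U attains the bound (`exists_card_zeros_eq`). This gives the minimum distance
of the dual, and its dimension 4.

For the code itself, (x - y)(x - z)^Q separates one point of U from two others, which excludes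
weights below 4 (`eq_zero_of_sum_pow_eq_zero`). A trace word with p^m + 1 ≥ 4 zeros yields a
codeword of weight 4 (`exists_mem_dualCode_range_of_vanishing`). -/

/-! ### Fixed points of powers of Frobenius. -/

section FrobeniusFixedPoints

variable {K : Type*} [Field K]

theorem pow_prime_pow_eq_self_of_dvd {p a b : ℕ} {x : K} (hab : a ∣ b) (ha : x ^ p ^ a = x) :
    x ^ p ^ b = x := by
  have h : Function.IsPeriodicPt (fun y : K => y ^ p) a x := by
    rw [Function.IsPeriodicPt, Function.IsFixedPt, pow_iterate]
    exact ha
  have h2 := h.trans_dvd hab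
  rwa [Function.IsPeriodicPt, Function.IsFixedPt, pow_iterate] at h2

theorem pow_prime_pow_gcd_eq_self {p a b : ℕ} {x : K} (ha : x ^ p ^ a = x)
    (hb : x ^ p ^ b = x) : x ^ p ^ Nat.gcd a b = x := by
  have h : Function.IsPeriodicPt (fun y : K => y ^ p) a x := by
    rw [Function.IsPeriodicPt, Function.IsFixedPt, pow_iterate]
    exact ha
  have h1 : Function.IsPeriodicPt (fun y : K => y ^ p) b x := by
    rw [Function.IsPeriodicPt, Function.IsFixedPt, pow_iterate]
    exact hb
  have h2 := h.gcd h1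
  rwa [Function.IsPeriodicPt, Function.IsFixedPt, pow_iterate] at h2

theorem card_le_of_forall_pow_prime_pow_eq_self {p n : ℕ} (hp : 1 < p) (hn : n ≠ 0)
    (S : Finset K) (hS : ∀ x ∈ S, x ^ p ^ n = x) : S.card ≤ p ^ n := by
  rw [← FiniteField.X_pow_card_pow_sub_X_natDegree_eq K hn hp]
  refine Polynomial.card_le_degree_of_subset_roots fun x hx => ?_
  rw [mem_roots (FiniteField.X_pow_card_pow_sub_X_ne_zero K hn hp)]
  simp [hS x (by simpa using hx)]

/-- The unit group is cyclic and p^n - 1 divides p^N - 1, so exactly p^n - 1 units are killed by the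
exponent p^n - 1; adjoin 0. -/
theorem exists_finset_pow_prime_pow_eq_self [Finite K] {p n N : ℕ} (hp : 1 < p)
    (hK : Nat.card K = p ^ N) (hn : n ∣ N) :
    ∃ S : Finset K, S.card = p ^ n ∧ ∀ x ∈ S, x ^ p ^ n = x := by
  classical
  have hpos : 0 < p ^ n := pow_pos (by lia) n
  have hker := IsCyclic.card_powMonoidHom_ker Kˣ (p ^ n - 1)
  rw [Nat.card_units, hK, Nat.pow_sub_one_gcd_pow_sub_one, Nat.gcd_eq_right hn] at hker
  have : Fintype (powMonoidHom (p ^ n - 1) : Kˣ →* Kˣ).ker := Fintype.ofFinite _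
  rw [Nat.card_eq_fintype_card] at hker
  let f : (powMonoidHom (p ^ n - 1) : Kˣ →* Kˣ).ker ↪ K :=
    ⟨fun u => ((u : Kˣ) : K), fun u v huv => Subtype.ext (Units.ext huv)⟩
  refine ⟨insert 0 (Finset.univ.map f), ?_, ?_⟩
  · rw [Finset.card_insert_of_notMem, Finset.card_map, Finset.card_univ, hker]
    · lia
    · intro h
      obtain ⟨u, -, hu⟩ := Finset.mem_map.1 h
      exact (u : Kˣ).ne_zero hu
  · intro x hx
    rcases Finset.mem_insert.1 hx with rfl | hx
    · exact zero_pow hpos.ne'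
    · obtain ⟨⟨u, hu⟩, -, rfl⟩ := Finset.mem_map.1 hx
      have h1 : (u : K) ^ (p ^ n - 1) = 1 := by
        have := MonoidHom.mem_ker.1 hu
        rw [powMonoidHom_apply] at this
        rw [← Units.val_pow_eq_pow_val, this, Units.val_one]
      change (u : K) ^ p ^ n = u
      rw [← Nat.sub_add_cancel hpos, pow_succ, h1, one_mul]

end FrobeniusFixedPoints

/-! ### Zeros of A + Bx + Cx^Q + Dx^(Q+1) on the (q+1)-th roots of unity. -/

section BilinearZeros

variable {K : Type*} [Field K]

/-- Four solutions `(x, y)` of the equation `A + B x + C y + D x y = 0` of a graph of a Möbius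
transformation have the same cross-ratio of `x`- and `y`-coordinates. -/
theorem cross_ratio_mul_eq {A B C D : K} (hne : ¬(A = 0 ∧ B = 0 ∧ C = 0 ∧ D = 0))
    {x₀ x₁ x₂ x₃ y₀ y₁ y₂ y₃ : K}
    (h₀ : A + B * x₀ + C * y₀ + D * (x₀ * y₀) = 0)
    (h₁ : A + B * x₁ + C * y₁ + D * (x₁ * y₁) = 0)
    (h₂ : A + B * x₂ + C * y₂ + D * (x₂ * y₂) = 0)
    (h₃ : A + B * x₃ + C * y₃ + D * (x₃ * y₃) = 0) :
    (x₃ - x₀) * (x₁ - x₂) * ((y₃ - y₂) * (y₁ - y₀)) =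
      (y₃ - y₀) * (y₁ - y₂) * ((x₃ - x₂) * (x₁ - x₀)) := by
  -- The coefficient vector is a nonzero kernel vector; the vanishing determinant is the cross-ratio
  -- identity.
  have hdet : Matrix.det !![1, x₀, y₀, x₀ * y₀; 1, x₁, y₁, x₁ * y₁; 1, x₂, y₂, x₂ * y₂;
      1, x₃, y₃, x₃ * y₃] = 0 := by
    refine Matrix.exists_mulVec_eq_zero_iff.1 ⟨![A, B, C, D], ?_, ?_⟩
    · intro h
      exact hne ⟨congrFun h 0, congrFun h 1, congrFun h 2, congrFun h 3⟩
    · ext j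
      fin_cases j <;> simp [Matrix.mulVec, dotProduct, Fin.sum_univ_four]
      · linear_combination h₀
      · linear_combination h₁
      · linear_combination h₂
      · linear_combination h₃
  simp [Matrix.det_succ_row_zero, Fin.sum_univ_succ, Fin.succAbove] at hdet
  linear_combination hdet

variable {p : ℕ} [hp : Fact p.Prime] [CharP K p]

/-- Normalising three zeros to 0, 1, ∞ by a Möbius map sends every other zero into the field of
order p^gcd(i,s), because its cross-ratio is fixed by both the p^i- and the p^s-power maps. The
summand 1 counts the zero sent to ∞. -/
theorem card_zeros_le {s i : ℕ} (hi : 0 < i) {A B C D : K}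
    (hne : ¬(A = 0 ∧ B = 0 ∧ C = 0 ∧ D = 0)) (S : Finset K)
    (hS : ∀ x ∈ S, x ^ (p ^ s + 1) = 1 ∧ A + B * x + C * x ^ p ^ i + D * (x * x ^ p ^ i) = 0) :
    S.card ≤ p ^ Nat.gcd i s + 1 := by
  classical
  have hpos : 0 < p ^ Nat.gcd i s := pow_pos hp.out.pos _
  by_cases hc : S.card ≤ 2
  · lia
  obtain ⟨x₀, h₀, x₁, h₁, x₂, h₂, h01, h02, h12⟩ := Finset.two_lt_card.1 (not_le.1 hc)
  have hinv : ∀ x ∈ S, x ≠ 0 ∧ x ^ p ^ s = x⁻¹ := by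
    intro x hx
    have h := (hS x hx).1
    have hx0 : x ≠ 0 := by
      rintro rfl
      simp at h
    refine ⟨hx0, ?_⟩
    rw [pow_succ] at h
    exact eq_inv_of_mul_eq_one_left h
  -- The cross-ratio taking x₀, x₁, x₂ to 0, 1, ∞; hence x₂ is erased below.
  let t : K → K := fun x => (x - x₀) * (x₁ - x₂) / ((x - x₂) * (x₁ - x₀))
  have htinj : Set.InjOn t (S.erase x₂ : Finset K) := by
    intro x hx y hy hxy
    have hx2 : x - x₂ ≠ 0 := sub_ne_zero.2 (Finset.ne_of_mem_erase hx)
    have hy2 : y - x₂ ≠ 0 := sub_ne_zero.2 (Finset.ne_of_mem_erase hy)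
    have h10 : x₁ - x₀ ≠ 0 := sub_ne_zero.2 h01.symm
    have h12' : x₁ - x₂ ≠ 0 := sub_ne_zero.2 h12
    have h02' : x₀ - x₂ ≠ 0 := sub_ne_zero.2 h02
    simp only [t] at hxy
    rw [div_eq_div_iff (mul_ne_zero hx2 h10) (mul_ne_zero hy2 h10)] at hxy
    refine sub_eq_zero.1 ((mul_eq_zero.1 ?_).resolve_left
      (mul_ne_zero (mul_ne_zero h10 h12') h02'))
    linear_combination hxy
  have hfix : ∀ y ∈ (S.erase x₂).image t, y ^ p ^ Nat.gcd i s = y := by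
    intro y hy
    obtain ⟨x, hx, rfl⟩ := Finset.mem_image.1 hy
    have hxS := Finset.mem_of_mem_erase hx
    have hx2 : x - x₂ ≠ 0 := sub_ne_zero.2 (Finset.ne_of_mem_erase hx)
    have h10 : x₁ - x₀ ≠ 0 := sub_ne_zero.2 h01.symm
    have hden := mul_ne_zero hx2 h10
    refine pow_prime_pow_gcd_eq_self ?_ ?_
    · simp only [t]
      have hden' := pow_ne_zero (p ^ i) hden
      rw [div_pow, div_eq_div_iff hden' hden]
      simp only [mul_pow, sub_pow_char_pow]
      rw [← cross_ratio_mul_eq hne (hS _ h₀).2 (hS _ h₁).2 (hS _ h₂).2 (hS _ hxS).2]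
    · simp only [t]
      have hden' := pow_ne_zero (p ^ s) hden
      rw [div_pow, div_eq_div_iff hden' hden]
      -- On these points the p^s-power map is inversion, which preserves cross-ratios.
      simp only [mul_pow, sub_pow_char_pow, (hinv _ h₀).2, (hinv _ h₁).2, (hinv _ h₂).2,
        (hinv _ hxS).2]
      have := (hinv _ h₀).1
      have := (hinv _ h₁).1
      have := (hinv _ h₂).1
      have := (hinv _ hxS).1
      field_simp
      ring
  have hle := card_le_of_forall_pow_prime_pow_eq_self hp.out.one_lt
    (Nat.gcd_pos_of_pos_left s hi).ne' _ hfix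
  rw [Finset.card_image_of_injOn htinj, Finset.card_erase_of_mem h₂] at hle
  lia

theorem exists_card_zeros_eq [Finite K] {s i : ℕ} (hs : 0 < s) (hK : Nat.card K = p ^ (2 * s)) :
    ∃ A B : K, (A, B) ≠ 0 ∧ ∃ S : Finset K, S.card = p ^ Nat.gcd i s + 1 ∧ ∀ x ∈ S,
      x ^ (p ^ s + 1) = 1 ∧
        A + B * x + B ^ p ^ s * x ^ p ^ i + A ^ p ^ s * (x * x ^ p ^ i) = 0 := by
  classical
  have : Fintype K := Fintype.ofFinite K
  have hqq : ∀ x : K, (x ^ p ^ s) ^ p ^ s = x := by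
    intro x
    rw [← pow_mul, ← pow_add, ← two_mul, ← hK, Nat.card_eq_fintype_card, FiniteField.pow_card]
  have hswap : ∀ x : K, (x ^ p ^ i) ^ p ^ s = (x ^ p ^ s) ^ p ^ i := fun x => by
    rw [← pow_mul, ← pow_mul, mul_comm]
  obtain ⟨c, hc⟩ : ∃ c : K, c ^ p ^ s ≠ c := by
    by_contra! h
    have h1 := card_le_of_forall_pow_prime_pow_eq_self hp.out.one_lt hs.ne' Finset.univ
      fun x _ => h x
    rw [Finset.card_univ, ← Nat.card_eq_fintype_card, hK] at h1
    exact absurd h1 (not_le.2 (Nat.pow_lt_pow_right hp.out.one_lt (by lia)))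
  obtain ⟨T, hTc, hT⟩ := exists_finset_pow_prime_pow_eq_self hp.out.one_lt hK
    ((Nat.gcd_dvd_right i s).trans (Dvd.intro_left 2 rfl))
  have hTi : ∀ t ∈ T, t ^ p ^ i = t := fun t ht =>
    pow_prime_pow_eq_self_of_dvd (Nat.gcd_dvd_left i s) (hT t ht)
  have hTs : ∀ t ∈ T, t ^ p ^ s = t := fun t ht =>
    pow_prime_pow_eq_self_of_dvd (Nat.gcd_dvd_right i s) (hT t ht)
  have hne : ∀ t ∈ T, t - c ≠ 0 := fun t ht h => by
    rw [sub_eq_zero] at h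
    exact hc (h ▸ hTs t ht)
  have hne' : ∀ t ∈ T, t - c ^ p ^ s ≠ 0 := fun t ht h => by
    rw [sub_eq_zero] at h
    have := hTs t ht
    rw [h, hqq] at this
    exact hc this.symm
  have hcc : c - c ^ p ^ s ≠ 0 := sub_ne_zero.2 hc.symm
  have hneg : ∀ n, (-1 : K) ^ p ^ n = -1 := fun n => by
    simpa [hp.out.ne_zero] using sub_pow_char_pow (0 : K) 1 n (p := p)
  -- The map t ↦ x = (c - t)/(t - c^q) carries the projective line over the field of order q into
  -- the (q+1)-th roots of unity, with ∞ ↦ -1. Substituting t = (c + c^q x)/(1 + x) into t^Q = t and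
  -- clearing denominators gives these coefficients.
  refine ⟨c ^ p ^ i - c, c ^ p ^ i - c ^ p ^ s, ?_,
    insert (-1) (T.image fun t => (c - t) / (t - c ^ p ^ s)), ?_, ?_⟩
  · intro h
    rw [Prod.mk_eq_zero] at h
    exact hcc (by linear_combination h.2 - h.1)
  · rw [Finset.card_insert_of_notMem, Finset.card_image_of_injOn, hTc]
    · intro t ht u hu htu
      dsimp only at htu
      rw [div_eq_div_iff (hne' t ht) (hne' u hu)] at htu
      refine sub_eq_zero.1 ((mul_eq_zero.1 ?_).resolve_left hcc)
      linear_combination -htu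
    · intro h
      obtain ⟨t, ht, h⟩ := Finset.mem_image.1 h
      rw [div_eq_iff (hne' t ht)] at h
      exact hcc (by linear_combination h)
  · intro x hx
    simp only [sub_pow_char_pow, hqq, hswap]
    rcases Finset.mem_insert.1 hx with rfl | hx
    · rw [pow_succ, hneg, hneg]
      constructor <;> ring
    · obtain ⟨t, ht, rfl⟩ := Finset.mem_image.1 hx
      have h1 := hne t ht
      have h2 := hne' t ht
      constructor
      · rw [pow_succ, div_pow, sub_pow_char_pow, sub_pow_char_pow, hqq, hTs t ht,
          div_mul_div_comm, div_eq_one_iff_eq (mul_ne_zero h1 h2)]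
        ring
      · have h3 : t - (c ^ p ^ s) ^ p ^ i ≠ 0 := by
          have := pow_ne_zero (p ^ i) h2
          rwa [sub_pow_char_pow, hTi t ht] at this
        rw [div_pow, sub_pow_char_pow, sub_pow_char_pow, hTi t ht]
        field_simp
        ring

end BilinearZeros

/-! ### Dual codes and words of small support. -/

section DualCode

variable {F : Type*} [Field F] {n : ℕ}

theorem dotProductBilin_nondegenerate :
    (dotProductBilin F F : LinearMap.BilinForm F (Fin n → F)).Nondegenerate := by
  refine ⟨fun v hv => dotProduct_eq_zero v hv, fun v hv => dotProduct_eq_zero v fun w => ?_⟩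
  rw [dotProduct_comm]
  exact hv w

theorem dualCode_eq_orthogonal (C : Submodule F (Fin n → F)) :
    dualCode C = LinearMap.BilinForm.orthogonal (dotProductBilin F F) C := by
  ext v
  rw [LinearMap.BilinForm.mem_orthogonal_iff]
  rfl

theorem finrank_dualCode (C : Submodule F (Fin n → F)) :
    Module.finrank F (dualCode C) = n - Module.finrank F C := by
  rw [dualCode_eq_orthogonal,
    LinearMap.BilinForm.finrank_orthogonal dotProductBilin_nondegenerate]
  simp

theorem dualCode_dualCode (C : Submodule F (Fin n → F)) : dualCode (dualCode C) = C := by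
  rw [dualCode_eq_orthogonal, dualCode_eq_orthogonal,
    LinearMap.BilinForm.orthogonal_orthogonal dotProductBilin_nondegenerate]
  intro v w h
  rw [dotProductBilin_apply_apply, dotProduct_comm]
  exact h

/-- If a nonzero word of a `k`-dimensional parametrised code vanishes on `k` positions, then these
positions support a nonzero word of the dual code. -/
theorem exists_mem_dualCode_range_of_vanishing {V : Type*} [AddCommGroup V] [Module F V]
    [FiniteDimensional F V] (T : V →ₗ[F] (Fin n → F)) {v : V} (hv : v ≠ 0) (J : Finset (Fin n))
    (hJ : J.card = Module.finrank F V) (hvJ : ∀ j ∈ J, T v j = 0) :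
    ∃ c ∈ dualCode (LinearMap.range T), c ≠ 0 ∧ ∀ j ∉ J, c j = 0 := by
  let res : (Fin n → F) →ₗ[F] (J → F) := LinearMap.funLeft F F (Subtype.val : J → Fin n)
  -- Restriction to J kills v, so by equality of dimensions it is not onto; a nonzero functional
  -- vanishing on its image is the required dual word.
  have hsurj : ¬ Function.Surjective (res ∘ₗ T) := by
    rw [← LinearMap.injective_iff_surjective_of_finrank_eq_finrank (by simp [hJ])]
    intro hinj
    refine hv (hinj ?_)
    rw [map_zero]
    ext j
    exact hvJ j j.2
  rw [← LinearMap.range_eq_top, ← ne_eq, ← lt_top_iff_ne_top] at hsurj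
  obtain ⟨f, hf, hle⟩ := Submodule.exists_le_ker_of_lt_top _ hsurj
  have hc : ∀ w, (dotProductEquiv F (Fin n)).symm (f ∘ₗ res) ⬝ᵥ w = f (res w) := fun w =>
    LinearMap.congr_fun ((dotProductEquiv F (Fin n)).apply_symm_apply (f ∘ₗ res)) w
  refine ⟨(dotProductEquiv F (Fin n)).symm (f ∘ₗ res), ?_, ?_, ?_⟩
  · rintro _ ⟨u, rfl⟩
    rw [dotProduct_comm, hc]
    exact hle ⟨u, rfl⟩
  · intro h
    refine hf (LinearMap.ext fun y => ?_)
    obtain ⟨w, rfl⟩ := LinearMap.funLeft_surjective_of_injective F F _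
      (Subtype.val_injective : Function.Injective (Subtype.val : J → Fin n)) y
    have := hc w
    rw [h, zero_dotProduct] at this
    exact this.symm
  · intro j hj
    have h1 := hc (Pi.single j 1)
    rw [dotProduct_single, mul_one] at h1
    have h2 : res (Pi.single j 1) = 0 := by
      ext k
      exact Pi.single_eq_of_ne (fun h => hj (by rw [← h]; exact k.2)) 1
    rw [h1, h2, map_zero]

theorem card_zeros_add_hammingNorm [DecidableEq F] (c : Fin n → F) :
    (Finset.univ.filter fun j => c j = 0).card + hammingNorm c = n := by
  rw [hammingNorm, Finset.card_filter_add_card_filter_not, Finset.card_univ, Fintype.card_fin]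

end DualCode

/-! ### BCH codes as duals of trace codes. -/

section CyclicCode

variable {F : Type*} [Field F] {n : ℕ}

theorem mem_cyclicCode_iff {g : F[X]} (hg : g ∣ X ^ n - 1) (c : Fin n → F) :
    c ∈ cyclicCode n g ↔ g ∣ ∑ i : Fin n, C (c i) * X ^ (i : ℕ) := by
  change Ideal.Quotient.mk _ (∑ i : Fin n, C (c i) * X ^ (i : ℕ)) ∈ Ideal.span {_} ↔ _
  have hmap : Ideal.span {Ideal.Quotient.mk (Ideal.span {(X ^ n - 1 : F[X])}) g} =
      (Ideal.span {g}).map (Ideal.Quotient.mk (Ideal.span {(X ^ n - 1 : F[X])})) := by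
    rw [Ideal.map_span, Set.image_singleton]
  rw [hmap, Ideal.mem_quotient_iff_mem_sup,
    sup_eq_left.2 (Ideal.span_singleton_le_span_singleton.2 hg), Ideal.mem_span_singleton]

variable {K : Type*} [Field K] [Algebra F K]

theorem mem_bchCode_iff {β : K} (hβ : β ^ n = 1) (δ h : ℕ) (c : Fin n → F) :
    c ∈ bchCode F n β δ h ↔
      ∀ k < δ - 1, ∑ j, algebraMap F K (c j) * (β ^ (j : ℕ)) ^ (h + k) = 0 := by
  classical
  have hdvd : ∀ f : F[X], bchGenerator F β δ h ∣ f ↔ ∀ k < δ - 1, aeval (β ^ (h + k)) f = 0 := by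
    intro f
    refine (@Finset.lcm_dvd_iff _ _ _ (_) _ _ _).trans ?_
    simp only [Finset.mem_range, minpoly.dvd_iff]
  rw [bchCode, mem_cyclicCode_iff, hdvd]
  · simp only [map_sum, map_mul, aeval_C, map_pow, aeval_X, pow_right_comm β]
  · rw [hdvd]
    intro k _
    rw [map_sub, map_pow, aeval_X, map_one, pow_right_comm, hβ, one_pow, sub_self]

/-- The words `(Tr (a x^h + b x^(h+1)))_x`, with `x = β ^ j` for `j = 0, …, n - 1`. -/
noncomputable def traceWord (F : Type*) {K : Type*} [Field F] [Field K] [Algebra F K] (n : ℕ)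
    (β : K) (h : ℕ) : (K × K) →ₗ[F] (Fin n → F) :=
  LinearMap.pi fun j => (Algebra.trace F K).comp
    ((LinearMap.mulRight F ((β ^ (j : ℕ)) ^ h)).coprod
      (LinearMap.mulRight F ((β ^ (j : ℕ)) ^ (h + 1))))

theorem traceWord_apply (β : K) (h : ℕ) (a b : K) (j : Fin n) :
    traceWord F n β h (a, b) j =
      Algebra.trace F K (a * (β ^ (j : ℕ)) ^ h + b * (β ^ (j : ℕ)) ^ (h + 1)) := by
  simp [traceWord]

theorem traceWord_dotProduct (β : K) (h : ℕ) (a b : K) (c : Fin n → F) :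
    traceWord F n β h (a, b) ⬝ᵥ c =
      Algebra.trace F K (a * ∑ j, algebraMap F K (c j) * (β ^ (j : ℕ)) ^ h +
        b * ∑ j, algebraMap F K (c j) * (β ^ (j : ℕ)) ^ (h + 1)) := by
  rw [Finset.mul_sum, Finset.mul_sum, ← Finset.sum_add_distrib, map_sum]
  refine Finset.sum_congr rfl fun j _ => ?_
  rw [traceWord_apply, mul_comm, ← smul_eq_mul, ← map_smul, Algebra.smul_def]
  congr 1
  ring

theorem bchCode_three_eq_dualCode [FiniteDimensional F K] [Algebra.IsSeparable F K] {β : K}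
    (hβ : β ^ n = 1) (h : ℕ) :
    bchCode F n β 3 h = dualCode (LinearMap.range (traceWord F n β h)) := by
  have hnd : ∀ x : K, (∀ a, Algebra.trace F K (a * x) = 0) → x = 0 := fun x hx =>
    (traceForm_nondegenerate F K).2 x fun a => hx a
  ext c
  rw [mem_bchCode_iff hβ]
  constructor
  · rintro hc _ ⟨⟨a, b⟩, rfl⟩
    have h0 := hc 0 (by norm_num)
    have h1 := hc 1 (by norm_num)
    rw [add_zero] at h0
    rw [traceWord_dotProduct, h0, h1, mul_zero, mul_zero, add_zero, map_zero]
  · intro hc k hk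
    have h0 := hnd _ fun a => by simpa [traceWord_dotProduct] using hc _ ⟨(a, 0), rfl⟩
    have h1 := hnd _ fun b => by simpa [traceWord_dotProduct] using hc _ ⟨(0, b), rfl⟩
    obtain rfl | rfl : k = 0 ∨ k = 1 := by lia
    exacts [h0, h1]

end CyclicCode

/-! ### Exponent arithmetic modulo q + 1. -/

section Exponents

variable {K : Type*} [Field K]

/-- The monomials `x^h`, `x^(h+1)` and their conjugates are, on the `(q+1)`-th roots of unity, the
products of a fixed power of `x` with `1`, `x`, `x^Q`, `x^(Q+1)`. -/
theorem exists_exponent {q Q h : ℕ} (hh : 2 * h + Q = q ∨ 2 * h + 1 = Q) :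
    ∃ e : ℕ,
      (∀ x : K, x ^ (q + 1) = 1 → x ^ e = x ^ h ∧ x ^ e * x = x ^ (h + 1) ∧
        x ^ e * x ^ Q = (x ^ (h + 1)) ^ q ∧ x ^ e * (x * x ^ Q) = (x ^ h) ^ q) ∨
      (∀ x : K, x ^ (q + 1) = 1 → x ^ e = (x ^ (h + 1)) ^ q ∧ x ^ e * x = (x ^ h) ^ q ∧
        x ^ e * x ^ Q = x ^ h ∧ x ^ e * (x * x ^ Q) = x ^ (h + 1)) := by
  have hconj : ∀ x : K, x ^ (q + 1) = 1 → ∀ k, (x ^ k) ^ q * x ^ k = 1 := by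
    intro x hx k
    rw [← pow_succ, pow_right_comm, hx, one_pow]
  have hcancel : ∀ x : K, x ^ (q + 1) = 1 → ∀ k y, y * x ^ k = 1 → y = (x ^ k) ^ q := by
    intro x hx k y hy
    rw [eq_inv_of_mul_eq_one_left hy, eq_inv_of_mul_eq_one_left (hconj x hx k)]
  rcases hh with hh | hh
  -- Here h + Q = q - h ≡ -(h + 1) modulo q + 1.
  · refine ⟨h, Or.inl fun x hx => ⟨rfl, (pow_succ x h).symm, hcancel x hx _ _ ?_,
      hcancel x hx _ _ ?_⟩⟩ <;>
    · rw [← hx, ← hh]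
      ring
  -- Here e ≡ -(h + 1), so e + 1 ≡ -h and e + Q ≡ h modulo q + 1.
  · refine ⟨(h + 1) * q, Or.inr fun x hx => ?_⟩
    have h1 := hconj x hx (h + 1)
    rw [← pow_mul] at h1
    refine ⟨pow_mul _ _ _, hcancel x hx _ _ ?_, ?_, ?_⟩
    · rw [← h1]
      ring
    · rw [← hh]
      linear_combination x ^ h * h1
    · rw [← hh]
      linear_combination x ^ (h + 1) * h1

variable {p : ℕ} [hp : Fact p.Prime] [CharP K p]

/-- A conjugation-symmetric sum of the four monomials is, up to a power of `x`, a
conjugation-symmetric bilinear form in `(1, x)` and `(1, x^Q)`. -/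
theorem exists_involutive_add_conj_eq {s Q h : ℕ} (hqq : ∀ x : K, (x ^ p ^ s) ^ p ^ s = x)
    (hh : 2 * h + Q = p ^ s ∨ 2 * h + 1 = Q) :
    ∃ (e : ℕ) (φ : K × K → K × K), Function.Involutive φ ∧ φ 0 = 0 ∧
      ∀ x : K, x ^ (p ^ s + 1) = 1 → ∀ v : K × K,
        (v.1 * x ^ h + v.2 * x ^ (h + 1)) + (v.1 * x ^ h + v.2 * x ^ (h + 1)) ^ p ^ s =
          x ^ e * ((φ v).1 + (φ v).2 * x + (φ v).2 ^ p ^ s * x ^ Q +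
            (φ v).1 ^ p ^ s * (x * x ^ Q)) := by
  obtain ⟨e, he | he⟩ := exists_exponent (K := K) hh
  · refine ⟨e, id, fun v => rfl, rfl, fun x hx v => ?_⟩
    obtain ⟨h1, h2, h3, h4⟩ := he x hx
    rw [add_pow_char_pow, mul_pow, mul_pow, ← h3, ← h4, ← h2, ← h1]
    simp only [id]
    ring
  -- The conjugate monomials now come first, so the coefficients are swapped and conjugated.
  · refine ⟨e, fun v => (v.2 ^ p ^ s, v.1 ^ p ^ s), fun v => by simp [hqq], ?_,
      fun x hx v => ?_⟩
    · simp [hp.out.ne_zero]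
    · obtain ⟨h1, h2, h3, h4⟩ := he x hx
      simp only [hqq]
      rw [add_pow_char_pow, mul_pow, mul_pow, ← h2, ← h1, ← h3, ← h4]
      ring

/-- The columns `(x^h, x^(h+1))` attached to at most three `(q+1)`-th roots of unity are linearly
independent over the subfield of order `q`. -/
theorem eq_zero_of_sum_pow_eq_zero {ι : Type*} [Fintype ι] [DecidableEq ι] {s i h : ℕ}
    (hh : 2 * h + p ^ i = p ^ s ∨ 2 * h + 1 = p ^ i) {c x : ι → K} (hx : Function.Injective x)
    (hx1 : ∀ j, x j ^ (p ^ s + 1) = 1) (hc : ∀ j, c j ^ p ^ s = c j)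
    (h0 : ∑ j, c j * x j ^ h = 0) (h1 : ∑ j, c j * x j ^ (h + 1) = 0)
    (J : Finset ι) (hJ : J.card ≤ 3) (hcJ : ∀ j ∉ J, c j = 0) : c = 0 := by
  have hconj : ∀ k, ∑ j, c j * x j ^ k = 0 → ∑ j, c j * (x j ^ k) ^ p ^ s = 0 := by
    intro k hk
    have := congrArg (fun y => y ^ p ^ s) hk
    simpa [sum_pow_char_pow, mul_pow, hc, hp.out.ne_zero] using this
  have h0' := hconj _ h0
  have h1' := hconj _ h1
  have hx0 : ∀ j, x j ≠ 0 := fun j hj => by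
    have := hx1 j
    simp [hj] at this
  obtain ⟨e, he⟩ := exists_exponent (K := K) hh
  have hsum : (∑ j, c j * (x j ^ e) = 0) ∧ (∑ j, c j * (x j ^ e * x j) = 0) ∧
      (∑ j, c j * (x j ^ e * x j ^ p ^ i) = 0) ∧
      (∑ j, c j * (x j ^ e * (x j * x j ^ p ^ i)) = 0) := by
    have hcongr : ∀ {f g : ι → K}, (∑ j, c j * g j = 0) → (∀ j, f j = g j) →
        ∑ j, c j * f j = 0 := fun h hfg => by simpa only [hfg] using h
    rcases he with he | he
    · exact ⟨hcongr h0 fun j => (he _ (hx1 j)).1, hcongr h1 fun j => (he _ (hx1 j)).2.1,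
        hcongr h1' fun j => (he _ (hx1 j)).2.2.1, hcongr h0' fun j => (he _ (hx1 j)).2.2.2⟩
    · exact ⟨hcongr h1' fun j => (he _ (hx1 j)).1, hcongr h0' fun j => (he _ (hx1 j)).2.1,
        hcongr h0 fun j => (he _ (hx1 j)).2.2.1, hcongr h1 fun j => (he _ (hx1 j)).2.2.2⟩
  obtain ⟨s0, s1, s2, s3⟩ := hsum
  funext k
  by_contra hk
  have hkJ : k ∈ J := by
    by_contra h
    exact hk (hcJ k h)
  -- y and z are the other points of J; if there is only one it is repeated, and if none, 0 serves
  -- since x k ≠ 0.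
  obtain ⟨y, z, hy, hz, hyz⟩ : ∃ y z : K, x k - y ≠ 0 ∧ x k - z ≠ 0 ∧
      ∀ j ∈ J.erase k, x j = y ∨ x j = z := by
    have hcard : (J.erase k).card ≤ 2 := by
      rw [Finset.card_erase_of_mem hkJ]
      lia
    have hne : ∀ j ∈ J.erase k, x k - x j ≠ 0 := fun j hj =>
      sub_ne_zero.2 fun h => Finset.ne_of_mem_erase hj (hx h).symm
    generalize J.erase k = E at hcard hne
    obtain h | h | h : E.card = 0 ∨ E.card = 1 ∨ E.card = 2 := by lia
    · rw [Finset.card_eq_zero] at h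
      exact ⟨0, 0, by simpa using hx0 k, by simpa using hx0 k, by simp [h]⟩
    · obtain ⟨a, rfl⟩ := Finset.card_eq_one.1 h
      exact ⟨x a, x a, hne a (by simp), hne a (by simp), by simp⟩
    · obtain ⟨a, b, -, rfl⟩ := Finset.card_eq_two.1 h
      exact ⟨x a, x b, hne a (by simp), hne b (by simp), by simp⟩
  -- Expanding (x - y)(x - z)^Q uses only 1, x, x^Q, x^(Q+1); the k-th term alone survives.
  have hsum : ∑ j, c j * (x j ^ e * ((x j - y) * (x j - z) ^ p ^ i)) = 0 := by
    have : ∀ j, c j * (x j ^ e * ((x j - y) * (x j - z) ^ p ^ i)) =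
        y * z ^ p ^ i * (c j * x j ^ e) - z ^ p ^ i * (c j * (x j ^ e * x j)) -
          y * (c j * (x j ^ e * x j ^ p ^ i)) + c j * (x j ^ e * (x j * x j ^ p ^ i)) := by
      intro j
      rw [sub_pow_char_pow]
      ring
    simp only [this, Finset.sum_add_distrib, Finset.sum_sub_distrib, ← Finset.mul_sum, s0, s1, s2,
      s3, mul_zero, sub_zero, add_zero]
  rw [Finset.sum_eq_single k] at hsum
  · exact mul_ne_zero hk (mul_ne_zero (pow_ne_zero _ (hx0 k))
      (mul_ne_zero hy (pow_ne_zero _ hz))) hsum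
  · intro j _ hj
    by_cases hjJ : j ∈ J
    · rcases hyz j (Finset.mem_erase.2 ⟨hj, hjJ⟩) with h | h
      · simp [h]
      · simp [h, hp.out.ne_zero]
    · simp [hcJ j hjJ]
  · simp

end Exponents

/-! ### Zero counts of trace words. -/

section TraceWords

variable {F K : Type*} [Field F] [Field K] [Algebra F K]
  {p : ℕ} [hp : Fact p.Prime] {s i h : ℕ} {β : K}

theorem algebraMap_trace_eq_add_pow [Finite K] {q : ℕ} (hF : Nat.card F = q)
    (hK : Module.finrank F K = 2) (x : K) :
    algebraMap F K (Algebra.trace F K x) = x + x ^ q := by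
  rw [FiniteField.algebraMap_trace_eq_sum_pow, hK, hF, Finset.sum_range_succ,
    Finset.sum_range_one, pow_zero, pow_one, pow_one]

theorem IsPrimitiveRoot.injective_fin_pow {M : Type*} [CommMonoid M] {n : ℕ} {ζ : M}
    (hζ : IsPrimitiveRoot ζ n) : Function.Injective fun j : Fin n => ζ ^ (j : ℕ) :=
  fun j k hjk => Fin.ext (hζ.pow_inj j.2 k.2 hjk)

/-- The zeros of the words of the trace code are those of a bilinear form. -/
theorem exists_involutive_traceWord_eq_zero_iff [Finite K] [CharP K p]
    (hh : 2 * h + p ^ i = p ^ s ∨ 2 * h + 1 = p ^ i)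
    (hF : Nat.card F = p ^ s) (hK : Module.finrank F K = 2)
    (hqq : ∀ x : K, (x ^ p ^ s) ^ p ^ s = x) (hβ : IsPrimitiveRoot β (p ^ s + 1)) :
    ∃ φ : K × K → K × K, Function.Involutive φ ∧ φ 0 = 0 ∧ ∀ v (j : Fin (p ^ s + 1)),
      traceWord F (p ^ s + 1) β h v j = 0 ↔
        (φ v).1 + (φ v).2 * β ^ (j : ℕ) + (φ v).2 ^ p ^ s * (β ^ (j : ℕ)) ^ p ^ i +
          (φ v).1 ^ p ^ s * (β ^ (j : ℕ) * (β ^ (j : ℕ)) ^ p ^ i) = 0 := by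
  obtain ⟨e, φ, hφ, hφ0, H⟩ := exists_involutive_add_conj_eq hqq hh
  refine ⟨φ, hφ, hφ0, fun v j => ?_⟩
  have hx : (β ^ (j : ℕ)) ^ (p ^ s + 1) = 1 := by rw [pow_right_comm, hβ.pow_eq_one, one_pow]
  rw [← map_eq_zero_iff _ (algebraMap F K).injective, ← Prod.mk.eta (p := v), traceWord_apply,
    algebraMap_trace_eq_add_pow hF hK, H _ hx, mul_eq_zero, or_iff_right]
  exact pow_ne_zero _ (pow_ne_zero _ (hβ.ne_zero (by simp)))

theorem card_zeros_traceWord_le [DecidableEq F] [Finite K] [CharP K p] (hi : 0 < i)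
    (hh : 2 * h + p ^ i = p ^ s ∨ 2 * h + 1 = p ^ i)
    (hF : Nat.card F = p ^ s) (hK : Module.finrank F K = 2)
    (hqq : ∀ x : K, (x ^ p ^ s) ^ p ^ s = x) (hβ : IsPrimitiveRoot β (p ^ s + 1))
    {v : K × K} (hv : v ≠ 0) :
    (Finset.univ.filter fun j => traceWord F (p ^ s + 1) β h v j = 0).card ≤
      p ^ Nat.gcd i s + 1 := by
  classical
  obtain ⟨φ, hφ, hφ0, H⟩ := exists_involutive_traceWord_eq_zero_iff hh hF hK hqq hβ
  rw [← Finset.card_image_of_injective _ hβ.injective_fin_pow]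
  refine card_zeros_le hi (A := (φ v).1) (B := (φ v).2) (C := (φ v).2 ^ p ^ s)
    (D := (φ v).1 ^ p ^ s) ?_ _ ?_
  · rintro ⟨h1, h2, -⟩
    refine hv (hφ.injective ?_)
    rw [hφ0]
    exact Prod.ext h1 h2
  · intro x hx
    obtain ⟨j, hj, rfl⟩ := Finset.mem_image.1 hx
    refine ⟨?_, (H v j).1 (Finset.mem_filter.1 hj).2⟩
    rw [pow_right_comm, hβ.pow_eq_one, one_pow]

theorem exists_card_zeros_traceWord_eq [DecidableEq F] [Finite K] [CharP K p] (hs : 0 < s) (hi : 0 < i)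
    (hh : 2 * h + p ^ i = p ^ s ∨ 2 * h + 1 = p ^ i)
    (hF : Nat.card F = p ^ s) (hK : Module.finrank F K = 2) (hKc : Nat.card K = p ^ (2 * s))
    (hqq : ∀ x : K, (x ^ p ^ s) ^ p ^ s = x) (hβ : IsPrimitiveRoot β (p ^ s + 1)) :
    ∃ v : K × K, v ≠ 0 ∧
      (Finset.univ.filter fun j => traceWord F (p ^ s + 1) β h v j = 0).card =
        p ^ Nat.gcd i s + 1 := by
  classical
  obtain ⟨φ, hφ, hφ0, H⟩ := exists_involutive_traceWord_eq_zero_iff hh hF hK hqq hβ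
  obtain ⟨A, B, hAB, S, hS, hS'⟩ := exists_card_zeros_eq (K := K) (p := p) (i := i) hs hKc
  have hv : φ (A, B) ≠ 0 := fun h0 => hAB (by rw [← hφ (A, B), h0, hφ0])
  refine ⟨φ (A, B), hv, (card_zeros_traceWord_le hi hh hF hK hqq hβ hv).antisymm ?_⟩
  rw [← hS, ← Finset.card_image_of_injective _ hβ.injective_fin_pow]
  refine Finset.card_le_card fun x hx => ?_
  obtain ⟨hx1, hx2⟩ := hS' x hx
  obtain ⟨j, hj, rfl⟩ := hβ.eq_pow_of_pow_eq_one hx1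
  refine Finset.mem_image.2 ⟨⟨j, hj⟩, Finset.mem_filter.2 ⟨Finset.mem_univ _, ?_⟩, rfl⟩
  rw [H, hφ]
  exact hx2

end TraceWords

/-! ### Parameters of the code and its dual. -/

theorem two_mul_add_eq_of_exponent {p s i h : ℕ} (hp : p.Prime) (hi : 0 < i) (his : i < s)
    (hh : h = (p ^ s - p ^ i) / 2 ∨ (Odd p ∧ h = (p ^ i - 1) / 2)) :
    2 * h + p ^ i = p ^ s ∨ 2 * h + 1 = p ^ i := by
  have hlt : p ^ i < p ^ s := Nat.pow_lt_pow_right hp.one_lt his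
  rcases hh with rfl | ⟨hodd, rfl⟩
  · left
    have hev : Even (p ^ s - p ^ i) := by
      rw [Nat.even_sub hlt.le, Nat.even_pow' (by lia), Nat.even_pow' hi.ne']
    have := Nat.two_mul_div_two_of_even hev
    lia
  · right
    obtain ⟨k, hk⟩ := hodd.pow (n := i)
    lia

theorem mainTheorem3
    (p s i m h : ℕ) (hp : p.Prime) (hs : 1 < s) (hi : 0 < i) (his : i < s)
    (hm : Nat.gcd i s = m) (hpm : 3 ≤ p ^ m)
    (hh : h = (p ^ s - p ^ i) / 2 ∨ (Odd p ∧ h = (p ^ i - 1) / 2))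
    {F K : Type*} [Field F] [DecidableEq F] [Field K] [Algebra F K]
    (hF : Nat.card F = p ^ s) (hK : Module.finrank F K = 2)
    (β : K) (hβ : IsPrimitiveRoot β (p ^ s + 1)) :
    IsAMDS (bchCode F (p ^ s + 1) β 3 h) ∧
    HasParameters (bchCode F (p ^ s + 1) β 3 h) (p ^ s - 3) 4 ∧
    HasParameters (dualCode (bchCode F (p ^ s + 1) β 3 h)) 4 (p ^ s - p ^ m) := by
  subst hm
  have := Fact.mk hp
  replace hh := two_mul_add_eq_of_exponent hp hi his hh
  have : Finite F := Nat.finite_of_card_ne_zero (by rw [hF]; exact pow_ne_zero _ hp.ne_zero)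
  have : FiniteDimensional F K := FiniteDimensional.of_finrank_pos (by lia)
  have : Finite K := Module.finite_of_finite F
  have hKc : Nat.card K = p ^ (2 * s) := by
    rw [Module.natCard_eq_pow_finrank (K := F), hF, hK, ← pow_mul, mul_comm]
  have : Fintype K := Fintype.ofFinite K
  have : Fintype F := Fintype.ofFinite F
  have : CharP K p := charP_of_card_eq_prime_pow (f := 2 * s) (by
    rw [← Nat.card_eq_fintype_card, hKc])
  have hqq : ∀ x : K, (x ^ p ^ s) ^ p ^ s = x := fun x => by
    rw [← pow_mul, ← pow_add, ← two_mul, ← hKc, Nat.card_eq_fintype_card, FiniteField.pow_card]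
  have hFq : ∀ c : F, c ^ p ^ s = c := fun c => by
    rw [← hF, Nat.card_eq_fintype_card, FiniteField.pow_card]
  have hmi : p ^ Nat.gcd i s ≤ p ^ i :=
    Nat.pow_le_pow_right hp.pos (Nat.le_of_dvd hi (Nat.gcd_dvd_left i s))
  have hlt : p ^ i < p ^ s := Nat.pow_lt_pow_right hp.one_lt his
  set T := traceWord F (p ^ s + 1) β h
  have hle : ∀ v : K × K, v ≠ 0 →
      (Finset.univ.filter fun j => T v j = 0).card ≤ p ^ Nat.gcd i s + 1 := fun v hv =>
    card_zeros_traceWord_le hi hh hF hK hqq hβ hv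
  obtain ⟨v, hv, hvcard⟩ : ∃ v : K × K, v ≠ 0 ∧
      (Finset.univ.filter fun j => T v j = 0).card = p ^ Nat.gcd i s + 1 :=
    exists_card_zeros_traceWord_eq (by lia) hi hh hF hK hKc hqq hβ
  -- A nonzero kernel vector would have q + 1 > p^m + 1 zeros.
  have hinj : Function.Injective T := by
    rw [injective_iff_map_eq_zero]
    intro w hw
    by_contra hne
    have := hle w hne
    simp [hw] at this
    lia
  have hfin : Module.finrank F (K × K) = 4 := by rw [Module.finrank_prod, hK]
  have hrange : Module.finrank F (LinearMap.range T) = 4 := by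
    rw [LinearMap.finrank_range_of_inj hinj, hfin]
  have hcode : bchCode F (p ^ s + 1) β 3 h = dualCode (LinearMap.range T) :=
    bchCode_three_eq_dualCode hβ.pow_eq_one h
  have hmin : ∀ c ∈ bchCode F (p ^ s + 1) β 3 h, c ≠ 0 → 4 ≤ hammingNorm c := by
    intro c hc hne
    by_contra! hlt4
    rw [mem_bchCode_iff hβ.pow_eq_one] at hc
    have h0 := eq_zero_of_sum_pow_eq_zero hh (c := fun j => algebraMap F K (c j))
      (x := fun j => β ^ (j : ℕ)) hβ.injective_fin_pow
      (fun j => by rw [pow_right_comm, hβ.pow_eq_one, one_pow])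
      (fun j => by rw [← map_pow, hFq]) (hc 0 (by norm_num)) (hc 1 (by norm_num))
      (Finset.univ.filter fun j => c j ≠ 0) (Nat.le_of_lt_succ hlt4)
      (fun j hj => by simpa using hj)
    refine hne (funext fun j => ?_)
    simpa using congrFun h0 j
  have hparam : HasParameters (bchCode F (p ^ s + 1) β 3 h) (p ^ s - 3) 4 := by
    refine ⟨?_, ?_, ?_⟩
    · rw [hcode, finrank_dualCode, hrange]
      lia
    -- The assumption p^m ≥ 3 provides the four zeros.
    · obtain ⟨J, hJ, hJcard⟩ := Finset.exists_subset_card_eq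
        (show 4 ≤ (Finset.univ.filter fun j => T v j = 0).card by lia)
      obtain ⟨c, hc, hc0, hcJ⟩ := exists_mem_dualCode_range_of_vanishing T hv J
        (hJcard.trans hfin.symm) fun j hj => (Finset.mem_filter.1 (hJ hj)).2
      rw [← hcode] at hc
      refine ⟨c, hc, hc0, (hmin c hc hc0).antisymm' ?_⟩
      rw [← hJcard]
      refine Finset.card_le_card fun j hj => ?_
      by_contra hjJ
      exact (Finset.mem_filter.1 hj).2 (hcJ j hjJ)
    · rintro _ ⟨c, hc, hc0, rfl⟩
      exact hmin c hc hc0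
  refine ⟨⟨_, _, hparam, by lia⟩, hparam, ?_⟩
  rw [hcode, dualCode_dualCode]
  refine ⟨hrange, ⟨T v, ⟨v, rfl⟩, fun h0 => hv (hinj (by rw [h0, map_zero])), ?_⟩, ?_⟩
  · have := card_zeros_add_hammingNorm (T v)
    lia
  · rintro _ ⟨_, ⟨w, rfl⟩, hw, rfl⟩
    have h1 := card_zeros_add_hammingNorm (T w)
    have h2 := hle w fun h0 => hw (by rw [h0, map_zero])
    lia
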